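/- **Setting.** Let $\mathcal C$ be a category, whose objects are called *groups* and whose morphisms are called *homomorphisms*; let each group $G$ be equipped with a poset $\mathsf{Sub}\,G$ of *subgroups*, and each homomorphism $f\colon X\to Y$ with a direct image map $A\mapsto fA$, $\mathsf{Sub}X\to\mathsf{Sub}Y$, and an inverse image map $B\mapsto f^{-1}B$, $\mathsf{Sub}Y\to\mathsf{Sub}X$. Whenever the bounds below exist, put $\mathsf{Im} f=f(\text{largest subgroup of }X)$ and $\mathsf{Ker} f=f^{-1}(\text{trivial, i.e. smallest, subgroup of }Y)$. A subgroup is *normal* if it is the kernel of some homomorphism, *conormal* if it is the image of some homomorphism. A homomorphism $m\colon M\to G$ is an *embedding associated to* $S\in\mathsf{Sub}\,G$ if $\mathsf{Im}\,m\subseteq S$ and every $f\colon U\to G$ with $\mathsf{Im} f\subseteq S$ is $f=mu$ for a unique $u$. Dually, $e\colon G\to Q$ is a *projection associated to* $S$ if $S\subseteq\mathsf{Ker}\,e$ and every $g\colon G\to V$ with $S\subseteq \mathsf{Ker}\, g$ is $g=ve$ for a unique $v$. Assume: 1. $fA\subseteq B\Leftrightarrow A\subseteq f^{-1}B$; the direct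 and inverse image maps of identities are identities, $(fg)A=f(gA)$ and $(fg)^{-1}B=g^{-1}(f^{-1}B)$. 2. Each $\mathsf{Sub}\,G$ is a bounded lattice; $ff^{-1}B=B\wedge \mathsf{Im} f$ and $f^{-1}fA=A\vee\mathsf{Ker} f$. 3. Each conormal subgroup has an associated embedding and each normal subgroup has an associated projection. 4. Each homomorphism $f$ factorizes as $f=mhe$ with $e$ a projection associated to $\mathsf{Ker} f$, $h$ an isomorphism, and $m$ an embedding associated to $\mathsf{Im} f$. 5. The join of two normal subgroups is normal and the meet of two conormal subgroups is conormal. **Zigzags.** A *zigzag* from $X_0$ to $X_n$ ($n\ge 0$) is a sequence of homomorphisms $f_1,\dots,f_n$, where $f_i$ is either right-pointing, $f_i\colon X_{i-1}\to X_i$, or left-pointing, $f_i\colon X_i\to X_{i-1}$. Chasing a subgroup $S$ of $X_0$ *forward* along the zigzag gives the subgroup $f_n^*\cdots f_1^*S$ of $X_n$, where $f_i^*$ is the direct image map of $f_i$ if $f_i$ is right-pointing and its inverse image map if $f_i$ is left-pointing. Chasing *backward* is chasing forward along the reversed zigzag. A zigzag is *collapsible* if all its left-pointing arrows are isomorphisms;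 its composite is then the composite $X_0\to X_n$ of its arrows, with the left-pointing ones replaced by their inverses. **Pyramids.** A *pyramid* on a zigzag is a triangular array of nodes $X_i^j$ ($0\le i\le j\le n$) with $X_i^i=X_i$, with an arrow (in one of the two directions) between $X_i^{j}$ and $X_{i}^{j+1}$ and between $X_{i}^{j+1}$ and $X_{i+1}^{j+1}$ for $i\le j<n$, as follows. In an array of this kind, we picture $X_i^j$ at height $j-i$. * *Triangles.* The arrows between $X_{i-1}$, $X_{i-1}^i$, $X_i$ form a factorization $f_i=me$, where $e$ is a projection associated to $\mathsf{Ker} f_i$, with codomain $X_{i-1}^i$, and $m$ is an embedding associated to $\mathsf{Im} f_i$. * *Diamonds.* For $1\le j\le i<n$ consider the bottom node $W=X_j^i$, the left node $X=X_{j-1}^i$, the right node $Y=X_j^{i+1}$ and the top node $Z=X_{j-1}^{i+1}$. If the bottom arrows are $n\colon W\to X$ and $r\colon W\to Y$, then the top arrows are $x\colon X\to Z$ and $y\colon Y\to Z$ with $xn=yr$ a projection associated to $\mathsf{Ker}\,n\vee\mathsf{Ker}\,r$. If the bottom arrows are $n\colon X\to W$ and $r\colon Y\to W$, then the top arrows are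 $x\colon Z\to X$ and $y\colon Z\to Y$ with $nx=ry$ an embedding associated to $\mathsf{Im}\,n\wedge\mathsf{Im}\,r$. If the bottom arrows compose to a homomorphism $g$ between $X$ and $Y$ (in either direction), then the top arrows form a factorization $g=me$ through $Z$ with $e$ a projection associated to $\mathsf{Ker}\,g$ and $m$ an embedding associated to $\mathsf{Im}\,g$. The *principal horizontal zigzag* of the pyramid is $X_0^0,X_0^1,\dots,X_0^n,X_1^n,\dots,X_n^n$. The given zigzag *induces a homomorphism* $h\colon X_0\to X_n$ if it has a pyramid whose principal horizontal zigzag is collapsible with composite $h$; $h$ is then called an *induced homomorphism*. **Theorem (Homomorphism Induction Theorem).** Under Axioms 1–5, a zigzag from $X_0$ to $X_n$ induces a homomorphism if and only if chasing the trivial subgroup of $X_0$ forward along the zigzag results in the trivial subgroup of $X_n$ and chasing the largest subgroup of $X_n$ backward along the zigzag results in the largest subgroup of $X_0$. Moreover, when a zigzag induces a homomorphism, the induced homomorphism $h$ is unique and does not depend on the pyramid (the principal horizontal zigzag of every pyramid on the zigzag is collapsible, with composite $h$), and for all subgroups $S$ of $X_0$ and $T$ of $X_n$, $hS$ is the result of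 chasing $S$ forward and $h^{-1}T$ is the result of chasing $T$ backward along the zigzag. -/

import Mathlib

open CategoryTheory

universe w v u

/-- The language of the theory on a category `C` whose objects are called groups and whose morphisms
are called homomorphisms, together with Axiom 1 and the first half of Axiom 2: every group has a
bounded lattice of subgroups, every homomorphism has a direct and an inverse image map, these form
a Galois connection, and they are functorial. -/
class SubgroupForm (C : Type u) [Category.{v} C] where
  /-- The subgroups of a group. -/
  Sub : C → Type w
  /-- Subgroups form a lattice under inclusion. -/
  subLattice : ∀ G : C, Lattice (Sub G)
  /-- Each group has a smallest subgroup `⊥` and a largest subgroup `⊤`. -/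
  subBounded : ∀ G : C, BoundedOrder (Sub G)
  /-- The direct image `fA`. -/
  direct : ∀ {X Y : C}, (X ⟶ Y) → Sub X → Sub Y
  /-- The inverse image `f⁻¹B`. -/
  inverse : ∀ {X Y : C}, (X ⟶ Y) → Sub Y → Sub X
  direct_le_iff : ∀ {X Y : C} (f : X ⟶ Y) (A : Sub X) (B : Sub Y),
    direct f A ≤ B ↔ A ≤ inverse f B
  direct_id : ∀ {X : C} (A : Sub X), direct (𝟙 X) A = A
  inverse_id : ∀ {X : C} (A : Sub X), inverse (𝟙 X) A = A
  direct_comp : ∀ {W X Y : C} (g : W ⟶ X) (f : X ⟶ Y) (A : Sub W),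
    direct (g ≫ f) A = direct f (direct g A)
  inverse_comp : ∀ {W X Y : C} (g : W ⟶ X) (f : X ⟶ Y) (B : Sub Y),
    inverse (g ≫ f) B = inverse g (inverse f B)

namespace SubgroupForm

attribute [reducible, instance] subLattice subBounded

variable {C : Type u} [Category.{v} C] [SubgroupForm.{w} C]

/-- The image of a homomorphism: the direct image of the largest subgroup. -/
def Im {X Y : C} (f : X ⟶ Y) : Sub Y := direct f ⊤

/-- The kernel of a homomorphism: the inverse image of the trivial subgroup. -/
def Ker {X Y : C} (f : X ⟶ Y) : Sub X := inverse f ⊥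

/-- A normal subgroup is one that is the kernel of some homomorphism. -/
def IsNormal {G : C} (S : Sub G) : Prop := ∃ (H : C) (f : G ⟶ H), S = Ker f

/-- A conormal subgroup is one that is the image of some homomorphism. -/
def IsConormal {G : C} (S : Sub G) : Prop := ∃ (F : C) (f : F ⟶ G), S = Im f

/-- `m` is an embedding associated to the subgroup `S` of `G`. -/
def IsEmbeddingOf {M G : C} (m : M ⟶ G) (S : Sub G) : Prop :=
  Im m ≤ S ∧ ∀ (U : C) (f : U ⟶ G), Im f ≤ S → ∃! t : U ⟶ M, t ≫ m = f

/-- `e` is a projection associated to the subgroup `S` of `G`. -/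
def IsProjectionOf {G Q : C} (e : G ⟶ Q) (S : Sub G) : Prop :=
  S ≤ Ker e ∧ ∀ (V : C) (g : G ⟶ V), S ≤ Ker g → ∃! t : Q ⟶ V, e ≫ t = g

end SubgroupForm

open SubgroupForm

/-- The remaining axioms of the self-dual theory. -/
class SelfDualAxioms (C : Type u) [Category.{v} C] [SubgroupForm.{w} C] : Prop where
  /-- Axiom 2, second half: `f f⁻¹ B = B ∧ Im f`. -/
  direct_inverse : ∀ {X Y : C} (f : X ⟶ Y) (B : Sub Y), direct f (inverse f B) = B ⊓ Im f
  /-- Axiom 2, second half: `f⁻¹ f A = A ∨ Ker f`. -/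
  inverse_direct : ∀ {X Y : C} (f : X ⟶ Y) (A : Sub X), inverse f (direct f A) = A ⊔ Ker f
  /-- Axiom 3: each conormal subgroup admits an embedding. -/
  exists_embedding : ∀ {G : C} (S : Sub G), IsConormal S →
    ∃ (M : C) (m : M ⟶ G), IsEmbeddingOf m S
  /-- Axiom 3: each normal subgroup admits a projection. -/
  exists_projection : ∀ {G : C} (S : Sub G), IsNormal S →
    ∃ (Q : C) (e : G ⟶ Q), IsProjectionOf e S
  /-- Axiom 4: each homomorphism is a projection associated to its kernel, followed by an
  isomorphism, followed by an embedding associated to its image. -/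
  exists_factorization : ∀ {X Y : C} (f : X ⟶ Y),
    ∃ (Q M : C) (e : X ⟶ Q) (h : Q ⟶ M) (m : M ⟶ Y),
      IsProjectionOf e (Ker f) ∧ IsIso h ∧ IsEmbeddingOf m (Im f) ∧ e ≫ h ≫ m = f
  /-- Axiom 5: the join of two normal subgroups is normal. -/
  sup_normal : ∀ {G : C} (A B : Sub G), IsNormal A → IsNormal B → IsNormal (A ⊔ B)
  /-- Axiom 5: the meet of two conormal subgroups is conormal. -/
  inf_conormal : ∀ {G : C} (A B : Sub G), IsConormal A → IsConormal B → IsConormal (A ⊓ B)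

/-- One step of a zigzag: a homomorphism between `X` (on the left) and `Y` (on the right) which
points either to the right or to the left. -/
inductive ZigArrow {C : Type u} [Category.{v} C] (X Y : C) : Type v
  | right (f : X ⟶ Y) : ZigArrow X Y
  | left (f : Y ⟶ X) : ZigArrow X Y

/-- A zigzag of homomorphisms from the initial node `X` to the final node `Y`. -/
inductive HomZigzag {C : Type u} [Category.{v} C] : C → C → Type (max u v)
  | nil (X : C) : HomZigzag X X
  | cons {X Y Z : C} (a : ZigArrow X Y) (z : HomZigzag Y Z) : HomZigzag X Z

namespace ZigArrow

variable {C : Type u} [Category.{v} C] [SubgroupForm.{w} C]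

/-- Chasing a subgroup from the left node to the right node. -/
def forward {X Y : C} : ZigArrow X Y → Sub X → Sub Y
  | right f, S => direct f S
  | left f, S => inverse f S

/-- Chasing a subgroup from the right node to the left node. -/
def backward {X Y : C} : ZigArrow X Y → Sub Y → Sub X
  | right f, T => inverse f T
  | left f, T => direct f T

/-- The triangles of a pyramid: over the arrow `f` between `X` and `Y`, with apex `Z`, sides `a`
and `b`, and `f` equal to a projection associated to its kernel (pointing up to `Z`) followed by an
embedding associated to its image (pointing down from `Z`). -/
def IsTriangle {X Y Z : C} : ZigArrow X Y → ZigArrow X Z → ZigArrow Z Y → Prop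
  | right f, right e, right m => IsProjectionOf e (Ker f) ∧ IsEmbeddingOf m (Im f) ∧ e ≫ m = f
  | left f, left m, left e => IsProjectionOf e (Ker f) ∧ IsEmbeddingOf m (Im f) ∧ e ≫ m = f
  | _, _, _ => False

/-- The diamonds of a pyramid, with left node `X`, right node `Y`, bottom node `W`, top node `Z`.
The first two arguments form the bottom wedge `X - W - Y`, the last two the top wedge `X - Z - Y`.

* If the bottom wedge is formed by `n : W ⟶ X` and `r : W ⟶ Y` (pointing up), the top wedge is
  formed by `x : X ⟶ Z` and `y : Y ⟶ Z` such that `n ≫ x = r ≫ y` is a projection associated to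
  `Ker n ⊔ Ker r`.
* If the bottom wedge is formed by `n : X ⟶ W` and `r : Y ⟶ W` (pointing down), dually.
* If both bottom arrows point to the right, or both to the left, the top wedge is a triangle over
  the composite of the bottom wedge. -/
def IsDiamond {X Y W Z : C} :
    ZigArrow X W → ZigArrow W Y → ZigArrow X Z → ZigArrow Z Y → Prop
  | left n, right r, right x, left y =>
      n ≫ x = r ≫ y ∧ IsProjectionOf (n ≫ x) (Ker n ⊔ Ker r)
  | right n, left r, left x, right y =>
      x ≫ n = y ≫ r ∧ IsEmbeddingOf (x ≫ n) (Im n ⊓ Im r)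
  | right l, right r, a, b => IsTriangle (right (l ≫ r)) a b
  | left l, left r, a, b => IsTriangle (left (r ≫ l)) a b
  | _, _, _, _ => False

end ZigArrow

namespace HomZigzag

section Category

variable {C : Type u} [Category.{v} C]

/-- Concatenation of zigzags. -/
def append {X Y Z : C} : HomZigzag X Y → HomZigzag Y Z → HomZigzag X Z
  | nil _, z => z
  | cons a y, z => cons a (append y z)

/-- A zigzag is collapsible when all its left-pointing arrows are isomorphisms. -/
def Collapsible {X Y : C} : HomZigzag X Y → Prop
  | nil _ => True
  | cons (.right _) z => z.Collapsible
  | cons (.left f) z => IsIso f ∧ z.Collapsible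

/-- The composite of a collapsible zigzag, in which the left-pointing arrows are replaced by their
inverses: the induced homomorphism of a collapsible zigzag. -/
noncomputable def collapse {X Y : C} : (z : HomZigzag X Y) → z.Collapsible → (X ⟶ Y)
  | nil X, _ => 𝟙 X
  | cons (.right f) z, h => f ≫ collapse z h
  | cons (.left f) z, h => (@CategoryTheory.inv _ _ _ _ f h.1) ≫ collapse z h.2

end Category

variable {C : Type u} [Category.{v} C] [SubgroupForm.{w} C]

/-- Chasing a subgroup of the initial node forward along a zigzag. -/
def chaseForward {X Y : C} : HomZigzag X Y → Sub X → Sub Y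
  | nil _, S => S
  | cons a z, S => z.chaseForward (a.forward S)

/-- Chasing a subgroup of the final node backward along a zigzag. -/
def chaseBackward {X Y : C} : HomZigzag X Y → Sub Y → Sub X
  | nil _, T => T
  | cons a z, T => a.backward (z.chaseBackward T)

/-- `IsStrip b L L' b'`: a strip of diamonds running upward along `L`,
```
         A' -b'- A
        /       /
      L'      L
      /       /
     Z --b-- W
```
where consecutive diamonds share an arrow. The bottom wedge of each diamond consists of the arrow
of the strip which is already there (at first `b`) and the next arrow of `L`; its top wedge consists
of the next arrow of `L'` and the arrow it shares with the next diamond (in the end `b'`). -/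
inductive IsStrip : {Z W A' A : C} →
    ZigArrow Z W → HomZigzag W A → HomZigzag Z A' → ZigArrow A' A → Prop
  | nil {Z W : C} (b : ZigArrow Z W) : IsStrip b (HomZigzag.nil W) (HomZigzag.nil Z) b
  | cons {Z W V T A' A : C} {b : ZigArrow Z W} {r : ZigArrow W V} {a : ZigArrow Z T}
      {c : ZigArrow T V} {L : HomZigzag V A} {L' : HomZigzag T A'} {b' : ZigArrow A' A}
      (hd : ZigArrow.IsDiamond b r a c) (hs : IsStrip c L L' b') :
      IsStrip b (HomZigzag.cons r L) (HomZigzag.cons a L') b'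

/-- `IsPyramid z L R`: there is a pyramid with base `z`, with top node `A`, with left side `L`
(running up from the initial node of `z` to `A`) and right side `R` (running down from `A` to the
final node of `z`).

For `z` without arrows the pyramid is a single node. A pyramid with base
`X₀ -f- X₁ - ⋯ - Xₙ` consists of a pyramid with base `X₁ - ⋯ - Xₙ`, of a triangle over `f`, with
sides `a` and `b`, and of a strip of diamonds which starts at `b`, and which runs up along the left
side of the smaller pyramid. Thus all the nodes and arrows of the usual triangular array
are present, with a triangle over each arrow of `z` and a diamond at each place above. -/
inductive IsPyramid : {X A Y : C} → HomZigzag X Y → HomZigzag X A → HomZigzag A Y → Prop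
  | nil (X : C) : IsPyramid (HomZigzag.nil X) (HomZigzag.nil X) (HomZigzag.nil X)
  | cons {X W Y Z A A' : C} {f : ZigArrow X W} {z : HomZigzag W Y}
      {L : HomZigzag W A} {R : HomZigzag A Y}
      {a : ZigArrow X Z} {b : ZigArrow Z W} {L' : HomZigzag Z A'} {b' : ZigArrow A' A}
      (hp : IsPyramid z L R) (ht : ZigArrow.IsTriangle f a b) (hs : IsStrip b L L' b') :
      IsPyramid (HomZigzag.cons f z) (HomZigzag.cons a L') (HomZigzag.cons b' R)

/-- The zigzag `z` induces the homomorphism `h`: in a pyramid with base `z`, the principal horizontal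
zigzag, which runs up the left side and down the right side, is collapsible, and `h` is its
composite. -/
def Induces {X Y : C} (z : HomZigzag X Y) (h : X ⟶ Y) : Prop :=
  ∃ (A : C) (L : HomZigzag X A) (R : HomZigzag A Y), IsPyramid z L R ∧
    ∃ hc : (L.append R).Collapsible, h = (L.append R).collapse hc

end HomZigzag

/-!
Call a homomorphism injective if its kernel is trivial and surjective if its image is the largest
subgroup. The existence of factorizations implies that the embeddings associated to conormal
subgroups are exactly the injective homomorphisms, that the projections associated to normal
subgroups are exactly the surjective ones, and that a homomorphism which is both is an isomorphism
(`isProjectionOf_ker`, `isEmbeddingOf_im`, `isIso_of_ker_of_im`).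

In a pyramid every arrow that points up is surjective and every arrow that points down is injective
(`Ascending`, `Descending`). For such arrows, chasing a subgroup along the bottom wedge of a diamond
gives the same result as chasing it along the top wedge (`IsDiamond.forward_eq`,
`IsDiamond.backward_eq`), so chasing along the base of a pyramid agrees with chasing along its
principal horizontal zigzag (`IsPyramid.forward_eq`, `IsPyramid.backward_eq`). A left-pointing arrow
in the right half of the principal zigzag is surjective, and chasing `⊥` forward ends in `⊥` exactly
when all of these have a trivial kernel. Dually, chasing `⊤` backward ends in `⊤` exactly when the
left-pointing arrows of the left half, which are injective, are also surjective. Hence the two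
chasing conditions say that the principal zigzag is collapsible, whichever pyramid is considered.

Every zigzag has a pyramid (`exists_isPyramid`), and a pyramid is determined by its base up to
isomorphism (`IsPyramid.unique`), since each triangle and each diamond is, up to isomorphism,
determined by the arrows at its bottom. Isomorphic collapsible zigzags have the same composite, so
the induced homomorphism does not depend on the pyramid.
-/

namespace SubgroupForm

variable {C : Type u} [Category.{v} C] [SubgroupForm.{w} C]

/-! ### Direct and inverse images -/

theorem gc {X Y : C} (f : X ⟶ Y) : GaloisConnection (direct f) (inverse f) :=
  fun A B => direct_le_iff f A B

theorem direct_bot {X Y : C} (f : X ⟶ Y) : direct f ⊥ = ⊥ := (gc f).l_bot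

theorem inverse_top {X Y : C} (f : X ⟶ Y) : inverse f ⊤ = ⊤ := (gc f).u_top

theorem im_comp {X Y Z : C} (f : X ⟶ Y) (g : Y ⟶ Z) : Im (f ≫ g) = direct g (Im f) :=
  direct_comp f g ⊤

theorem ker_comp {X Y Z : C} (f : X ⟶ Y) (g : Y ⟶ Z) : Ker (f ≫ g) = inverse f (Ker g) :=
  inverse_comp f g ⊥

theorem im_comp_le {X Y Z : C} (f : X ⟶ Y) (g : Y ⟶ Z) : Im (f ≫ g) ≤ Im g := by
  rw [im_comp]; exact (gc g).monotone_l le_top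

theorem ker_le_comp {X Y Z : C} (f : X ⟶ Y) (g : Y ⟶ Z) : Ker f ≤ Ker (f ≫ g) := by
  rw [ker_comp]; exact (gc f).monotone_u bot_le

theorem im_eq_top_of_comp {X Y Z : C} {f : X ⟶ Y} {g : Y ⟶ Z} (h : Im (f ≫ g) = ⊤) :
    Im g = ⊤ :=
  top_le_iff.1 (h ▸ im_comp_le f g)

theorem ker_eq_bot_of_comp {X Y Z : C} {f : X ⟶ Y} {g : Y ⟶ Z} (h : Ker (f ≫ g) = ⊥) :
    Ker f = ⊥ :=
  le_bot_iff.1 (h ▸ ker_le_comp f g)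

theorem im_id (X : C) : Im (𝟙 X) = ⊤ := direct_id ⊤

theorem ker_id (X : C) : Ker (𝟙 X) = ⊥ := inverse_id ⊥

theorem im_eq_top_of_isIso {X Y : C} (f : X ⟶ Y) [IsIso f] : Im f = ⊤ :=
  im_eq_top_of_comp (f := inv f) (by rw [IsIso.inv_hom_id, im_id])

theorem ker_eq_bot_of_isIso {X Y : C} (f : X ⟶ Y) [IsIso f] : Ker f = ⊥ :=
  ker_eq_bot_of_comp (g := inv f) (by rw [IsIso.hom_inv_id, ker_id])

theorem inverse_direct_of_isIso {X Y : C} (f : X ⟶ Y) [IsIso f] (A : Sub X) :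
    inverse f (direct f A) = A := by
  refine le_antisymm ?_ ((gc f).le_u_l A)
  have h2 : direct f (inverse f (direct f A)) ≤ direct f A := (gc f).l_u_le _
  have h3 := (gc (inv f)).monotone_l h2
  rwa [← direct_comp, ← direct_comp, IsIso.hom_inv_id, direct_id, direct_id] at h3

theorem direct_inv {X Y : C} (f : X ⟶ Y) [IsIso f] (B : Sub Y) :
    direct (inv f) B = inverse f B := by
  have h := inverse_direct_of_isIso f (direct (inv f) B)
  rwa [← direct_comp, IsIso.inv_hom_id, direct_id, eq_comm] at h

theorem inverse_inv {X Y : C} (f : X ⟶ Y) [IsIso f] (A : Sub X) :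
    inverse (inv f) A = direct f A := by
  rw [← direct_inv (inv f), IsIso.inv_inv]

theorem inverse_sup_of_isIso {X Y : C} (f : X ⟶ Y) [IsIso f] (A B : Sub Y) :
    inverse f (A ⊔ B) = inverse f A ⊔ inverse f B := by
  simp only [← direct_inv]; exact (gc (inv f)).l_sup

theorem direct_inf_of_isIso {X Y : C} (f : X ⟶ Y) [IsIso f] (A B : Sub X) :
    direct f (A ⊓ B) = direct f A ⊓ direct f B := by
  simp only [← inverse_inv]; exact (gc (inv f)).u_inf

theorem ker_comp_of_ker_eq_bot {X Y Z : C} (f : X ⟶ Y) {g : Y ⟶ Z} (h : Ker g = ⊥) :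
    Ker (f ≫ g) = Ker f := by
  rw [ker_comp, h]; rfl

theorem im_comp_of_im_eq_top {X Y Z : C} {f : X ⟶ Y} (g : Y ⟶ Z) (h : Im f = ⊤) :
    Im (f ≫ g) = Im g := by
  rw [im_comp, h]; rfl

theorem isProjectionOf_id (X : C) : IsProjectionOf (𝟙 X) (⊥ : Sub X) :=
  ⟨bot_le, fun _ g _ => ⟨g, Category.id_comp g, fun t ht => by rw [← ht, Category.id_comp]⟩⟩

theorem isEmbeddingOf_id (X : C) : IsEmbeddingOf (𝟙 X) (⊤ : Sub X) :=
  ⟨le_top, fun _ g _ => ⟨g, Category.comp_id g, fun t ht => by rw [← ht, Category.comp_id]⟩⟩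

theorem IsProjectionOf.epi {G Q : C} {e : G ⟶ Q} {S : Sub G} (h : IsProjectionOf e S) : Epi e :=
  ⟨fun _ t hst => (h.2 _ (e ≫ t) (h.1.trans (ker_le_comp e t))).unique hst rfl⟩

theorem IsEmbeddingOf.mono {M G : C} {m : M ⟶ G} {S : Sub G} (h : IsEmbeddingOf m S) : Mono m :=
  ⟨fun _ t hst => (h.2 _ (t ≫ m) ((im_comp_le t m).trans h.1)).unique hst rfl⟩

/-- Projections associated to the same subgroup differ by an isomorphism. -/
theorem IsProjectionOf.exists_isIso {G P Q : C} {p : G ⟶ P} {q : G ⟶ Q} {S : Sub G}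
    (hp : IsProjectionOf p S) (hq : IsProjectionOf q S) : ∃ t : P ⟶ Q, IsIso t ∧ p ≫ t = q := by
  obtain ⟨t, ht, -⟩ := hp.2 _ q hq.1
  obtain ⟨s, hs, -⟩ := hq.2 _ p hp.1
  have := hp.epi
  have := hq.epi
  refine ⟨t, ⟨s, ?_, ?_⟩, ht⟩
  · rw [← cancel_epi p, ← Category.assoc, ht, hs, Category.comp_id]
  · rw [← cancel_epi q, ← Category.assoc, hs, ht, Category.comp_id]

/-- Embeddings associated to the same subgroup differ by an isomorphism. -/
theorem IsEmbeddingOf.exists_isIso {G P Q : C} {p : P ⟶ G} {q : Q ⟶ G} {S : Sub G}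
    (hp : IsEmbeddingOf p S) (hq : IsEmbeddingOf q S) : ∃ t : Q ⟶ P, IsIso t ∧ t ≫ p = q := by
  obtain ⟨t, ht, -⟩ := hp.2 _ q hq.1
  obtain ⟨s, hs, -⟩ := hq.2 _ p hp.1
  have := hp.mono
  have := hq.mono
  refine ⟨t, ⟨s, ?_, ?_⟩, ht⟩
  · rw [← cancel_mono q, Category.assoc, hs, ht, Category.id_comp]
  · rw [← cancel_mono p, Category.assoc, ht, hs, Category.id_comp]

theorem IsProjectionOf.comp_isIso {G P Q : C} {p : G ⟶ P} {S : Sub G} (hp : IsProjectionOf p S)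
    (i : P ⟶ Q) [IsIso i] : IsProjectionOf (p ≫ i) S := by
  refine ⟨hp.1.trans (ker_le_comp p i), fun V g hg => ?_⟩
  obtain ⟨t, ht, hu⟩ := hp.2 V g hg
  refine ⟨inv i ≫ t, by simpa using ht, fun s hs => ?_⟩
  rw [← hu (i ≫ s) (by simpa using hs), IsIso.inv_hom_id_assoc]

theorem IsEmbeddingOf.isIso_comp {G P Q : C} {p : P ⟶ G} {S : Sub G} (hp : IsEmbeddingOf p S)
    (i : Q ⟶ P) [IsIso i] : IsEmbeddingOf (i ≫ p) S := by
  refine ⟨(im_comp_le i p).trans hp.1, fun V g hg => ?_⟩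
  obtain ⟨t, ht, hu⟩ := hp.2 V g hg
  refine ⟨t ≫ inv i, by simpa using ht, fun s hs => ?_⟩
  rw [← hu (s ≫ i) (by simpa using hs), Category.assoc, IsIso.hom_inv_id, Category.comp_id]

/-! ### Projections are surjective, embeddings are injective -/

theorem IsProjectionOf.ker_eq {G Q : C} {e : G ⟶ Q} {S : Sub G} (h : IsProjectionOf e S)
    (hS : IsNormal S) : Ker e = S := by
  obtain ⟨H, f, rfl⟩ := hS
  obtain ⟨t, rfl, -⟩ := h.2 _ f le_rfl
  exact le_antisymm (ker_le_comp e t) h.1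

theorem IsEmbeddingOf.im_eq {M G : C} {m : M ⟶ G} {S : Sub G} (h : IsEmbeddingOf m S)
    (hS : IsConormal S) : Im m = S := by
  obtain ⟨H, f, rfl⟩ := hS
  obtain ⟨t, rfl, -⟩ := h.2 _ f le_rfl
  exact le_antisymm h.1 (im_comp_le t m)

theorem im_comp_eq_top {X Y Z : C} {f : X ⟶ Y} {g : Y ⟶ Z} (hf : Im f = ⊤) (hg : Im g = ⊤) :
    Im (f ≫ g) = ⊤ := by
  rw [im_comp_of_im_eq_top g hf, hg]

theorem ker_comp_eq_bot {X Y Z : C} {f : X ⟶ Y} {g : Y ⟶ Z} (hf : Ker f = ⊥) (hg : Ker g = ⊥) :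
    Ker (f ≫ g) = ⊥ := by
  rw [ker_comp_of_ker_eq_bot f hg, hf]

theorem ker_isNormal {X Y : C} (f : X ⟶ Y) : IsNormal (Ker f) := ⟨Y, f, rfl⟩

theorem im_isConormal {X Y : C} (f : X ⟶ Y) : IsConormal (Im f) := ⟨X, f, rfl⟩

variable [SelfDualAxioms C]

/-- In a factorization `e = e' ≫ i ≫ m`, the projection `e'` differs from `e` by an isomorphism, so
`i ≫ m` is an isomorphism. Hence `m` has image `⊤`, which is at most the image of `e`. -/
theorem IsProjectionOf.im_eq_top {G Q : C} {e : G ⟶ Q} {S : Sub G} (h : IsProjectionOf e S)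
    (hS : IsNormal S) : Im e = ⊤ := by
  obtain ⟨P, M, e', i, m, he', hi, hm, hf⟩ := SelfDualAxioms.exists_factorization e
  rw [h.ker_eq hS] at he'
  obtain ⟨t, ht, htt⟩ := he'.exists_isIso h
  have := he'.epi
  have : i ≫ m = t := by rw [← cancel_epi e', hf, htt]
  have ht' : Im (i ≫ m) = ⊤ := this ▸ im_eq_top_of_isIso t
  exact top_le_iff.1 (im_eq_top_of_comp ht' ▸ hm.1)

/-- Dual to `IsProjectionOf.im_eq_top`. -/
theorem IsEmbeddingOf.ker_eq_bot {M G : C} {m : M ⟶ G} {S : Sub G} (h : IsEmbeddingOf m S)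
    (hS : IsConormal S) : Ker m = ⊥ := by
  obtain ⟨P, N, e, i, m', he, hi, hm', hf⟩ := SelfDualAxioms.exists_factorization m
  rw [h.im_eq hS] at hm'
  obtain ⟨t, ht, htt⟩ := hm'.exists_isIso h
  have := hm'.mono
  have : e ≫ i = t := by rw [← cancel_mono m', Category.assoc, hf, htt]
  have ht' : Ker (e ≫ i) = ⊥ := this ▸ ker_eq_bot_of_isIso t
  exact le_bot_iff.1 (ker_eq_bot_of_comp ht' ▸ he.1)

/-- A surjective homomorphism is a projection associated to its kernel. -/
theorem isProjectionOf_ker {X Y : C} {f : X ⟶ Y} (h : Im f = ⊤) : IsProjectionOf f (Ker f) := by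
  obtain ⟨P, M, e, i, m, he, hi, hm, hf⟩ := SelfDualAxioms.exists_factorization f
  rw [h] at hm
  obtain ⟨t, ht, rfl⟩ := (isEmbeddingOf_id Y).exists_isIso hm
  have := he.comp_isIso (i ≫ t ≫ 𝟙 Y)
  rwa [hf] at this

/-- An injective homomorphism is an embedding associated to its image. -/
theorem isEmbeddingOf_im {X Y : C} {f : X ⟶ Y} (h : Ker f = ⊥) : IsEmbeddingOf f (Im f) := by
  obtain ⟨P, M, e, i, m, he, hi, hm, hf⟩ := SelfDualAxioms.exists_factorization f
  rw [h] at he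
  obtain ⟨t, ht, rfl⟩ := (isProjectionOf_id X).exists_isIso he
  have := hm.isIso_comp ((𝟙 X ≫ t) ≫ i)
  rwa [Category.assoc, hf] at this

theorem epi_of_im {X Y : C} {f : X ⟶ Y} (h : Im f = ⊤) : Epi f := (isProjectionOf_ker h).epi

theorem mono_of_ker {X Y : C} {f : X ⟶ Y} (h : Ker f = ⊥) : Mono f := (isEmbeddingOf_im h).mono

theorem isIso_of_ker_of_im {X Y : C} {f : X ⟶ Y} (hk : Ker f = ⊥) (hi : Im f = ⊤) : IsIso f := by
  have h := isProjectionOf_ker hi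
  rw [hk] at h
  obtain ⟨t, ht, rfl⟩ := (isProjectionOf_id X).exists_isIso h
  infer_instance

theorem direct_inverse_of_im {X Y : C} {f : X ⟶ Y} (h : Im f = ⊤) (B : Sub Y) :
    direct f (inverse f B) = B := by
  rw [SelfDualAxioms.direct_inverse, h, inf_top_eq]

theorem inverse_direct_of_ker {X Y : C} {f : X ⟶ Y} (h : Ker f = ⊥) (A : Sub X) :
    inverse f (direct f A) = A := by
  rw [SelfDualAxioms.inverse_direct, h, sup_bot_eq]

/-- Surjective homomorphisms with the same kernel differ by an isomorphism. -/
theorem exists_iso_of_ker_eq {W P Q : C} {p : W ⟶ P} {q : W ⟶ Q} (hp : Im p = ⊤) (hq : Im q = ⊤)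
    (h : Ker p = Ker q) : ∃ t : P ≅ Q, p ≫ t.hom = q := by
  obtain ⟨t, ht, htt⟩ := (isProjectionOf_ker hp).exists_isIso (h ▸ isProjectionOf_ker hq)
  exact ⟨asIso t, htt⟩

/-- Injective homomorphisms with the same image differ by an isomorphism. -/
theorem exists_iso_of_im_eq {W P Q : C} {p : P ⟶ W} {q : Q ⟶ W} (hp : Ker p = ⊥) (hq : Ker q = ⊥)
    (h : Im p = Im q) : ∃ t : P ≅ Q, t.hom ≫ q = p := by
  obtain ⟨t, ht, htt⟩ := (isEmbeddingOf_im hq).exists_isIso (h ▸ isEmbeddingOf_im hp)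
  exact ⟨asIso t, htt⟩

/-- A factorization into a surjective and an injective homomorphism is determined up to isomorphism,
and isomorphic homomorphisms have isomorphic factorizations. -/
theorem exists_iso_of_factorization {X Y Z X' Y' Z' : C} {e : X ⟶ Z} {m : Z ⟶ Y} {e' : X' ⟶ Z'}
    {m' : Z' ⟶ Y'} (he : Im e = ⊤) (hm : Ker m = ⊥) (he' : Im e' = ⊤) (hm' : Ker m' = ⊥)
    (φ : X ≅ X') (ψ : Y ≅ Y') (h : (e ≫ m) ≫ ψ.hom = φ.hom ≫ e' ≫ m') :
    ∃ χ : Z ≅ Z', e ≫ χ.hom = φ.hom ≫ e' ∧ m ≫ ψ.hom = χ.hom ≫ m' := by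
  obtain ⟨χ, hχ⟩ := exists_iso_of_ker_eq (p := e) (q := φ.hom ≫ e') he
    (im_comp_eq_top (im_eq_top_of_isIso φ.hom) he') (by
      rw [← ker_comp_of_ker_eq_bot e hm,
        ← ker_comp_of_ker_eq_bot (e ≫ m) (ker_eq_bot_of_isIso ψ.hom), h, ← Category.assoc,
        ker_comp_of_ker_eq_bot _ hm'])
  refine ⟨χ, hχ, ?_⟩
  have := epi_of_im he
  rw [← cancel_epi e, ← Category.assoc, h, ← Category.assoc, ← hχ, Category.assoc]

/-- In a commutative square of surjective homomorphisms `n ≫ x = r ≫ y` whose diagonal has kernel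
`Ker n ⊔ Ker r`, chasing along the lower wedge is the same as chasing along the upper wedge. -/
theorem direct_inverse_of_sup {W X Y Z : C} {n : W ⟶ X} {r : W ⟶ Y} {x : X ⟶ Z} {y : Y ⟶ Z}
    (hn : Im n = ⊤) (hr : Im r = ⊤) (h : n ≫ x = r ≫ y) (hk : Ker (n ≫ x) = Ker n ⊔ Ker r)
    (S : Sub X) : direct r (inverse n S) = inverse y (direct x S) := by
  have hy : Ker y = direct r (Ker n) := by
    rw [← direct_inverse_of_im hr (Ker y), ← ker_comp, ← h, hk, (gc r).l_sup]
    exact sup_eq_left.2 (((gc r).l_u_le ⊥).trans bot_le)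
  calc direct r (inverse n S)
      = direct r (inverse n S) ⊔ Ker y := by
        rw [hy]; exact (sup_eq_left.2 ((gc r).monotone_l ((gc n).monotone_u bot_le))).symm
    _ = inverse y (direct y (direct r (inverse n S))) := (SelfDualAxioms.inverse_direct y _).symm
    _ = inverse y (direct x S) := by
        rw [← direct_comp, ← h, direct_comp, direct_inverse_of_im hn]

/-- In a commutative square of injective homomorphisms `x ≫ n = y ≫ r` whose diagonal has image
`Im n ⊓ Im r`, chasing along the lower wedge is the same as chasing along the upper wedge. -/
theorem inverse_direct_of_inf {W X Y Z : C} {n : X ⟶ W} {r : Y ⟶ W} {x : Z ⟶ X} {y : Z ⟶ Y}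
    (hn : Ker n = ⊥) (hr : Ker r = ⊥) (h : x ≫ n = y ≫ r) (hk : Im (x ≫ n) = Im n ⊓ Im r)
    (S : Sub X) : inverse r (direct n S) = direct y (inverse x S) := by
  have hy : Im y = inverse r (Im n) := by
    rw [← inverse_direct_of_ker hr (Im y), ← im_comp, ← h, hk, (gc r).u_inf]
    exact inf_eq_left.2 (le_top.trans ((gc r).le_u_l ⊤))
  calc inverse r (direct n S)
      = inverse r (direct n S) ⊓ Im y := by
        rw [hy]; exact (inf_eq_left.2 ((gc r).monotone_u ((gc n).monotone_l le_top))).symm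
    _ = direct y (inverse y (inverse r (direct n S))) := (SelfDualAxioms.direct_inverse y _).symm
    _ = direct y (inverse x S) := by
        rw [← inverse_comp, ← h, inverse_comp, inverse_direct_of_ker hn]

end SubgroupForm

/-! ### Triangles and diamonds -/

namespace ZigArrow

/-- Two arrows of zigzags are related by isomorphisms of their nodes if they point the same way and
the square which they form with the isomorphisms commutes. -/
def Similar {C : Type u} [Category.{v} C] {X Y X' Y' : C} (φ : X ≅ X') (ψ : Y ≅ Y') :
    ZigArrow X Y → ZigArrow X' Y' → Prop
  | right f, right f' => f ≫ ψ.hom = φ.hom ≫ f'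
  | left f, left f' => f ≫ φ.hom = ψ.hom ≫ f'
  | _, _ => False

theorem Similar.refl {C : Type u} [Category.{v} C] {X Y : C} (a : ZigArrow X Y) :
    Similar (Iso.refl X) (Iso.refl Y) a a := by
  cases a <;> simp [Similar]

variable {C : Type u} [Category.{v} C] [SubgroupForm.{w} C]

/-- An arrow on the way up from the left node to the right node: surjective if it points up,
injective if it points down. -/
def Ascending {X Y : C} : ZigArrow X Y → Prop
  | right e => Im e = ⊤
  | left m => Ker m = ⊥

/-- An arrow on the way down from the left node to the right node: injective if it points down,
surjective if it points up. -/
def Descending {X Y : C} : ZigArrow X Y → Prop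
  | right m => Ker m = ⊥
  | left e => Im e = ⊤

theorem IsTriangle.forward_eq {X Y Z : C} {f : ZigArrow X Y} {a : ZigArrow X Z} {b : ZigArrow Z Y}
    (h : IsTriangle f a b) (S : Sub X) : b.forward (a.forward S) = f.forward S := by
  cases f <;> cases a <;> cases b <;> simp only [IsTriangle] at h
  · simp only [forward, ← h.2.2, direct_comp]
  · simp only [forward, ← h.2.2, inverse_comp]

theorem IsTriangle.backward_eq {X Y Z : C} {f : ZigArrow X Y} {a : ZigArrow X Z} {b : ZigArrow Z Y}
    (h : IsTriangle f a b) (T : Sub Y) : a.backward (b.backward T) = f.backward T := by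
  cases f <;> cases a <;> cases b <;> simp only [IsTriangle] at h
  · simp only [backward, ← h.2.2, inverse_comp]
  · simp only [backward, ← h.2.2, direct_comp]

variable [SelfDualAxioms C]

theorem IsTriangle.ascending {X Y Z : C} {f : ZigArrow X Y} {a : ZigArrow X Z} {b : ZigArrow Z Y}
    (h : IsTriangle f a b) : a.Ascending := by
  cases f <;> cases a <;> cases b <;> simp only [IsTriangle] at h
  · exact h.1.im_eq_top (ker_isNormal _)
  · exact h.2.1.ker_eq_bot (im_isConormal _)

theorem IsTriangle.descending {X Y Z : C} {f : ZigArrow X Y} {a : ZigArrow X Z} {b : ZigArrow Z Y}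
    (h : IsTriangle f a b) : b.Descending := by
  cases f <;> cases a <;> cases b <;> simp only [IsTriangle] at h
  · exact h.2.1.ker_eq_bot (im_isConormal _)
  · exact h.1.im_eq_top (ker_isNormal _)

theorem exists_isTriangle {X Y : C} (f : ZigArrow X Y) :
    ∃ (Z : C) (a : ZigArrow X Z) (b : ZigArrow Z Y), IsTriangle f a b := by
  cases f with
  | right f =>
    obtain ⟨Q, M, e, i, m, he, hi, hm, hf⟩ := SelfDualAxioms.exists_factorization f
    exact ⟨Q, right e, right (i ≫ m), he, hm.isIso_comp i, hf⟩
  | left f =>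
    obtain ⟨Q, M, e, i, m, he, hi, hm, hf⟩ := SelfDualAxioms.exists_factorization f
    exact ⟨Q, left (i ≫ m), left e, he, hm.isIso_comp i, hf⟩

theorem IsTriangle.unique {X Y Z X' Y' Z' : C} {f : ZigArrow X Y} {a : ZigArrow X Z}
    {b : ZigArrow Z Y} {f' : ZigArrow X' Y'} {a' : ZigArrow X' Z'} {b' : ZigArrow Z' Y'}
    (h : IsTriangle f a b) (h' : IsTriangle f' a' b') {φ : X ≅ X'} {ψ : Y ≅ Y'}
    (hf : Similar φ ψ f f') : ∃ χ : Z ≅ Z', Similar φ χ a a' ∧ Similar χ ψ b b' := by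
  have ha := h.ascending
  have hb := h.descending
  have ha' := h'.ascending
  have hb' := h'.descending
  cases f <;> cases a <;> cases b <;> simp only [IsTriangle] at h <;>
    cases f' <;> cases a' <;> cases b' <;> simp only [IsTriangle] at h' <;>
    simp only [Similar] at hf
  · exact exists_iso_of_factorization ha hb ha' hb' φ ψ (by rw [h.2.2, h'.2.2, hf])
  · obtain ⟨χ, h1, h2⟩ :=
      exists_iso_of_factorization hb ha hb' ha' ψ φ (by rw [h.2.2, h'.2.2, hf])
    exact ⟨χ, h2, h1⟩

section Diamond

variable {X Y W Z : C} {b : ZigArrow X W} {r : ZigArrow W Y} {a : ZigArrow X Z} {c : ZigArrow Z Y}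

theorem IsDiamond.ascending (h : IsDiamond b r a c) : a.Ascending := by
  cases b <;> cases r
  · exact IsTriangle.ascending h
  · cases a <;> cases c <;> simp only [IsDiamond] at h
    exact ker_eq_bot_of_comp
      (h.2.ker_eq_bot (SelfDualAxioms.inf_conormal _ _ (im_isConormal _) (im_isConormal _)))
  · cases a <;> cases c <;> simp only [IsDiamond] at h
    exact im_eq_top_of_comp
      (h.2.im_eq_top (SelfDualAxioms.sup_normal _ _ (ker_isNormal _) (ker_isNormal _)))
  · exact IsTriangle.ascending h

theorem IsDiamond.descending (h : IsDiamond b r a c) : c.Descending := by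
  cases b <;> cases r
  · exact IsTriangle.descending h
  · cases a <;> cases c <;> simp only [IsDiamond] at h
    have := h.2.ker_eq_bot (SelfDualAxioms.inf_conormal _ _ (im_isConormal _) (im_isConormal _))
    exact ker_eq_bot_of_comp (h.1 ▸ this)
  · cases a <;> cases c <;> simp only [IsDiamond] at h
    have := h.2.im_eq_top (SelfDualAxioms.sup_normal _ _ (ker_isNormal _) (ker_isNormal _))
    exact im_eq_top_of_comp (h.1 ▸ this)
  · exact IsTriangle.descending h

theorem IsDiamond.forward_eq (h : IsDiamond b r a c) (hb : b.Descending) (hr : r.Ascending)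
    (S : Sub X) : c.forward (a.forward S) = r.forward (b.forward S) := by
  cases b <;> cases r
  · rw [IsTriangle.forward_eq h]; exact direct_comp _ _ _
  · cases a <;> cases c <;> simp only [IsDiamond] at h
    exact (inverse_direct_of_inf hb hr h.1 (h.2.im_eq
      (SelfDualAxioms.inf_conormal _ _ (im_isConormal _) (im_isConormal _))) S).symm
  · cases a <;> cases c <;> simp only [IsDiamond] at h
    exact (direct_inverse_of_sup hb hr h.1 (h.2.ker_eq
      (SelfDualAxioms.sup_normal _ _ (ker_isNormal _) (ker_isNormal _))) S).symm
  · rw [IsTriangle.forward_eq h]; exact inverse_comp _ _ _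

theorem IsDiamond.backward_eq (h : IsDiamond b r a c) (hb : b.Descending) (hr : r.Ascending)
    (T : Sub Y) : a.backward (c.backward T) = b.backward (r.backward T) := by
  cases b <;> cases r
  · rw [IsTriangle.backward_eq h]; exact inverse_comp _ _ _
  · cases a <;> cases c <;> simp only [IsDiamond] at h
    exact (inverse_direct_of_inf hr hb h.1.symm ((congrArg Im h.1.symm).trans ((h.2.im_eq
      (SelfDualAxioms.inf_conormal _ _ (im_isConormal _) (im_isConormal _))).trans
        (inf_comm _ _))) T).symm
  · cases a <;> cases c <;> simp only [IsDiamond] at h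
    exact (direct_inverse_of_sup hr hb h.1.symm ((congrArg Ker h.1.symm).trans ((h.2.ker_eq
      (SelfDualAxioms.sup_normal _ _ (ker_isNormal _) (ker_isNormal _))).trans
        (sup_comm _ _))) T).symm
  · rw [IsTriangle.backward_eq h]; exact direct_comp _ _ _

theorem exists_isDiamond (hb : b.Descending) (hr : r.Ascending) :
    ∃ (Z : C) (a : ZigArrow X Z) (c : ZigArrow Z Y), IsDiamond b r a c := by
  cases b with
  | right n =>
    cases r with
    | right r => exact exists_isTriangle (right (n ≫ r))
    | left r =>
      obtain ⟨Z, m, hm⟩ := SelfDualAxioms.exists_embedding (Im n ⊓ Im r)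
        (SelfDualAxioms.inf_conormal _ _ (im_isConormal _) (im_isConormal _))
      obtain ⟨x, hx, -⟩ := (isEmbeddingOf_im hb).2 _ m (hm.1.trans inf_le_left)
      obtain ⟨y, hy, -⟩ := (isEmbeddingOf_im hr).2 _ m (hm.1.trans inf_le_right)
      exact ⟨Z, left x, right y, hx.trans hy.symm, hx.symm ▸ hm⟩
  | left n =>
    cases r with
    | right r =>
      obtain ⟨Z, m, hm⟩ := SelfDualAxioms.exists_projection (Ker n ⊔ Ker r)
        (SelfDualAxioms.sup_normal _ _ (ker_isNormal _) (ker_isNormal _))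
      obtain ⟨x, hx, -⟩ := (isProjectionOf_ker hb).2 _ m (le_sup_left.trans hm.1)
      obtain ⟨y, hy, -⟩ := (isProjectionOf_ker hr).2 _ m (le_sup_right.trans hm.1)
      exact ⟨Z, right x, left y, hx.trans hy.symm, hx.symm ▸ hm⟩
    | left r => exact exists_isTriangle (left (r ≫ n))

/-- The top of a diamond is determined up to isomorphism by its bottom. The diagonals of the two
diamonds correspond because they have the same kernel or the same image; the squares over the single
arrows then commute because the bottom arrows can be cancelled. -/
theorem IsDiamond.unique {X' Y' W' Z' : C} {b' : ZigArrow X' W'} {r' : ZigArrow W' Y'}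
    {a' : ZigArrow X' Z'} {c' : ZigArrow Z' Y'} (h : IsDiamond b r a c)
    (h' : IsDiamond b' r' a' c') (hb : b.Descending) (hr : r.Ascending) (hb' : b'.Descending)
    (hr' : r'.Ascending) {φ : X ≅ X'} {ω : W ≅ W'} {ψ : Y ≅ Y'} (hbb : Similar φ ω b b')
    (hrr : Similar ω ψ r r') :
    ∃ χ : Z ≅ Z', Similar φ χ a a' ∧ Similar χ ψ c c' := by
  cases b <;> cases r <;> cases b' <;> cases r' <;> simp only [Similar] at hbb hrr
  · rename_i n r n' r'
    refine IsTriangle.unique (f := right (n ≫ r)) (f' := right (n' ≫ r')) h h' ?_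
    simp only [Similar]
    rw [Category.assoc, hrr, ← Category.assoc, hbb, Category.assoc]
  · rename_i n r n' r'
    cases a <;> cases c <;> simp only [IsDiamond] at h
    cases a' <;> cases c' <;> simp only [IsDiamond] at h'
    rename_i x y x' y'
    -- The diagonals `Z ⟶ W` and `Z' ⟶ W'` are injective, with images related by `ω`.
    have hc := SelfDualAxioms.inf_conormal _ _ (im_isConormal n) (im_isConormal r)
    have hc' := SelfDualAxioms.inf_conormal _ _ (im_isConormal n') (im_isConormal r')
    obtain ⟨χ, hχ⟩ := exists_iso_of_im_eq (p := (x ≫ n) ≫ ω.hom) (q := x' ≫ n')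
      (ker_comp_eq_bot (h.2.ker_eq_bot hc) (ker_eq_bot_of_isIso _)) (h'.2.ker_eq_bot hc') (by
        rw [im_comp, h.2.im_eq hc, direct_inf_of_isIso, h'.2.im_eq hc', ← im_comp, ← im_comp,
          hbb, hrr, im_comp_of_im_eq_top _ (im_eq_top_of_isIso _),
          im_comp_of_im_eq_top _ (im_eq_top_of_isIso _)])
    have : Mono n' := mono_of_ker hb'
    have : Mono r' := mono_of_ker hr'
    refine ⟨χ, ?_, ?_⟩
    · simp only [Similar]
      rw [← cancel_mono n', Category.assoc, ← hbb, Category.assoc, hχ, Category.assoc]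
    · simp only [Similar]
      rw [← cancel_mono r', Category.assoc, ← hrr, Category.assoc, ← h'.1, hχ, h.1, Category.assoc]
  · rename_i n r n' r'
    cases a <;> cases c <;> simp only [IsDiamond] at h
    cases a' <;> cases c' <;> simp only [IsDiamond] at h'
    rename_i x y x' y'
    -- The diagonals `W ⟶ Z` and `W' ⟶ Z'` are surjective, with kernels related by `ω`.
    have hc := SelfDualAxioms.sup_normal _ _ (ker_isNormal n) (ker_isNormal r)
    have hc' := SelfDualAxioms.sup_normal _ _ (ker_isNormal n') (ker_isNormal r')
    obtain ⟨χ, hχ⟩ := exists_iso_of_ker_eq (p := n ≫ x) (q := ω.hom ≫ n' ≫ x')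
      (h.2.im_eq_top hc) (im_comp_eq_top (im_eq_top_of_isIso _) (h'.2.im_eq_top hc')) (by
        rw [ker_comp ω.hom, h.2.ker_eq hc, h'.2.ker_eq hc', inverse_sup_of_isIso, ← ker_comp,
          ← ker_comp, ← hbb, ← hrr, ker_comp_of_ker_eq_bot _ (ker_eq_bot_of_isIso _),
          ker_comp_of_ker_eq_bot _ (ker_eq_bot_of_isIso _)])
    have : Epi n := epi_of_im hb
    have : Epi r := epi_of_im hr
    refine ⟨χ, ?_, ?_⟩
    · simp only [Similar]
      rw [← cancel_epi n, ← Category.assoc, hχ, ← Category.assoc, ← hbb, Category.assoc]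
    · simp only [Similar]
      rw [← cancel_epi r, ← Category.assoc, ← h.1, hχ, h'.1, ← Category.assoc, ← hrr,
        Category.assoc]
  · rename_i n r n' r'
    refine IsTriangle.unique (f := left (r ≫ n)) (f' := left (r' ≫ n')) h h' ?_
    simp only [Similar]
    rw [Category.assoc, hbb, ← Category.assoc, hrr, Category.assoc]

end Diamond

end ZigArrow

/-! ### Zigzags -/

namespace HomZigzag

/-- Two zigzags are related by isomorphisms of their initial and final nodes if their inner nodes
admit isomorphisms for which all the squares commute. -/
inductive Similar {C : Type u} [Category.{v} C] : {X Y X' Y' : C} →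
    (X ≅ X') → (Y ≅ Y') → HomZigzag X Y → HomZigzag X' Y' → Prop
  | nil {X X' : C} (φ : X ≅ X') : Similar φ φ (nil X) (nil X')
  | cons {X Y Z X' Y' Z' : C} {φ : X ≅ X'} {ψ : Y ≅ Y'} {χ : Z ≅ Z'} {a : ZigArrow X Y}
      {a' : ZigArrow X' Y'} {z : HomZigzag Y Z} {z' : HomZigzag Y' Z'}
      (ha : ZigArrow.Similar φ ψ a a') (hz : Similar ψ χ z z') :
      Similar φ χ (cons a z) (cons a' z')

section Category

variable {C : Type u} [Category.{v} C]

theorem Similar.append {X Y Z X' Y' Z' : C} {φ : X ≅ X'} {ψ : Y ≅ Y'} {χ : Z ≅ Z'}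
    {L : HomZigzag X Y} {L' : HomZigzag X' Y'} {R : HomZigzag Y Z} {R' : HomZigzag Y' Z'}
    (hL : Similar φ ψ L L') (hR : Similar ψ χ R R') :
    Similar φ χ (L.append R) (L'.append R') := by
  induction hL with
  | nil φ => exact hR
  | cons ha _ ih => exact .cons ha (ih hR)

theorem Similar.collapse_eq {X Y X' Y' : C} {φ : X ≅ X'} {ψ : Y ≅ Y'} {z : HomZigzag X Y}
    {z' : HomZigzag X' Y'} (h : Similar φ ψ z z') (hc : z.Collapsible) (hc' : z'.Collapsible) :
    z.collapse hc ≫ ψ.hom = φ.hom ≫ z'.collapse hc' := by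
  induction h with
  | nil φ => simp [collapse]
  | @cons X Y Z X' Y' Z' φ ψ χ a a' z z' ha hz ih =>
    cases a <;> cases a' <;> simp only [ZigArrow.Similar] at ha
    · simp only [collapse]
      rw [Category.assoc, ih hc hc', ← Category.assoc, ha, Category.assoc]
    · rename_i f f'
      have := hc.1
      have := hc'.1
      simp only [collapse]
      rw [Category.assoc, ih hc.2 hc'.2, IsIso.inv_comp_eq, ← Category.assoc, ha]
      simp

theorem collapsible_append {X Y Z : C} (L : HomZigzag X Y) (R : HomZigzag Y Z) :
    (L.append R).Collapsible ↔ L.Collapsible ∧ R.Collapsible := by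
  induction L with
  | nil => simp [append, Collapsible]
  | cons a L ih => cases a <;> simp [append, Collapsible, ih, and_assoc]

/-- All arrows of a zigzag satisfy a given condition. -/
def All (P : ∀ {X Y : C}, ZigArrow X Y → Prop) {X Y : C} : HomZigzag X Y → Prop
  | nil _ => True
  | cons a z => P a ∧ All P z

end Category

variable {C : Type u} [Category.{v} C] [SubgroupForm.{w} C]

theorem chaseForward_append {X Y Z : C} (L : HomZigzag X Y) (R : HomZigzag Y Z) (S : Sub X) :
    (L.append R).chaseForward S = R.chaseForward (L.chaseForward S) := by
  induction L with
  | nil => rfl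
  | cons a L ih => exact ih R _

theorem chaseBackward_append {X Y Z : C} (L : HomZigzag X Y) (R : HomZigzag Y Z) (T : Sub Z) :
    (L.append R).chaseBackward T = L.chaseBackward (R.chaseBackward T) := by
  induction L with
  | nil => rfl
  | cons a L ih => exact congrArg a.backward (ih R)

theorem direct_collapse {X Y : C} (z : HomZigzag X Y) (hc : z.Collapsible) (S : Sub X) :
    direct (z.collapse hc) S = z.chaseForward S := by
  induction z with
  | nil => exact direct_id S
  | cons a z ih =>
    cases a with
    | right f => exact (direct_comp _ _ _).trans (ih hc _)
    | left f =>
      have := hc.1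
      refine (direct_comp _ _ _).trans ((ih hc.2 _).trans ?_)
      rw [direct_inv]; rfl

theorem inverse_collapse {X Y : C} (z : HomZigzag X Y) (hc : z.Collapsible) (T : Sub Y) :
    inverse (z.collapse hc) T = z.chaseBackward T := by
  induction z with
  | nil => exact inverse_id T
  | cons a z ih =>
    cases a with
    | right f => exact (inverse_comp _ _ _).trans (congrArg _ (ih hc T))
    | left f =>
      have := hc.1
      refine (inverse_comp _ _ _).trans ((congrArg _ (ih hc.2 T)).trans ?_)
      rw [inverse_inv]; rfl

variable [SelfDualAxioms C]

/-- Along the way down every chasing map reflects `⊥`: the direct image maps of injective and the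
inverse image maps of surjective homomorphisms are injective. So if `S` is chased to `⊥`, all the
subgroups met on the way are `⊥`, and each left-pointing arrow has kernel `⊥`. -/
theorem eq_bot_of_chaseForward {X Y : C} {R : HomZigzag X Y} (hR : R.All ZigArrow.Descending)
    {S : Sub X} (h : R.chaseForward S = ⊥) : S = ⊥ ∧ R.Collapsible := by
  induction R with
  | nil => exact ⟨h, trivial⟩
  | cons a R ih =>
    obtain ⟨h1, h2⟩ := ih hR.2 h
    cases a with
    | right f =>
      refine ⟨?_, h2⟩
      rw [← inverse_direct_of_ker hR.1 S]
      exact (congrArg (inverse f) h1).trans hR.1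
    | left f =>
      have h1 : inverse f S = ⊥ := h1
      have hS : S = ⊥ := by rw [← direct_inverse_of_im hR.1 S, h1, direct_bot]
      exact ⟨hS, isIso_of_ker_of_im ((congrArg (inverse f) hS).symm.trans h1) hR.1, h2⟩

/-- Chasing backward along the way up reflects `⊤`, by the argument dual to that of
`eq_bot_of_chaseForward`, so each left-pointing arrow has image `⊤`. -/
theorem collapsible_of_chaseBackward {X Y : C} {L : HomZigzag X Y}
    (hL : L.All ZigArrow.Ascending) {T : Sub Y} (h : L.chaseBackward T = ⊤) : L.Collapsible := by
  induction L with
  | nil => trivial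
  | cons a L ih =>
    cases a with
    | right f =>
      have h : inverse f (L.chaseBackward T) = ⊤ := h
      refine ih hL.2 (T := T) ?_
      rw [← direct_inverse_of_im hL.1 (L.chaseBackward T), h]
      exact hL.1
    | left f =>
      have h : direct f (L.chaseBackward T) = ⊤ := h
      refine ⟨isIso_of_ker_of_im hL.1 (top_le_iff.1 (h ▸ (gc f).monotone_l le_top)), ?_⟩
      refine ih hL.2 (T := T) ?_
      rw [← inverse_direct_of_ker hL.1 (L.chaseBackward T), h, inverse_top]

/-! ### Strips and pyramids -/

/-- Each arrow shared by two diamonds of a strip is descending if the previous one is, and the other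
new arrows of the strip are ascending. -/
theorem IsStrip.all {Z W A' A : C} {b : ZigArrow Z W} {L : HomZigzag W A} {L' : HomZigzag Z A'}
    {b' : ZigArrow A' A} (h : IsStrip b L L' b') (hb : b.Descending) :
    L'.All ZigArrow.Ascending ∧ b'.Descending := by
  induction h with
  | nil => exact ⟨trivial, hb⟩
  | cons hd _ ih => exact ⟨⟨hd.ascending, (ih hd.descending).1⟩, (ih hd.descending).2⟩

theorem IsStrip.forward_eq {Z W A' A : C} {b : ZigArrow Z W} {L : HomZigzag W A}
    {L' : HomZigzag Z A'} {b' : ZigArrow A' A} (h : IsStrip b L L' b') (hb : b.Descending)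
    (hL : L.All ZigArrow.Ascending) (S : Sub Z) :
    b'.forward (L'.chaseForward S) = L.chaseForward (b.forward S) := by
  induction h with
  | nil => rfl
  | cons hd _ ih =>
    simp only [chaseForward]
    rw [ih hd.descending hL.2, hd.forward_eq hb hL.1]

theorem IsStrip.backward_eq {Z W A' A : C} {b : ZigArrow Z W} {L : HomZigzag W A}
    {L' : HomZigzag Z A'} {b' : ZigArrow A' A} (h : IsStrip b L L' b') (hb : b.Descending)
    (hL : L.All ZigArrow.Ascending) (T : Sub A) :
    L'.chaseBackward (b'.backward T) = b.backward (L.chaseBackward T) := by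
  induction h with
  | nil => rfl
  | cons hd _ ih =>
    simp only [chaseBackward]
    rw [ih hd.descending hL.2, hd.backward_eq hb hL.1]

theorem exists_isStrip {Z W A : C} {b : ZigArrow Z W} {L : HomZigzag W A} (hb : b.Descending)
    (hL : L.All ZigArrow.Ascending) :
    ∃ (A' : C) (L' : HomZigzag Z A') (b' : ZigArrow A' A), IsStrip b L L' b' := by
  induction L generalizing Z with
  | nil => exact ⟨_, _, _, .nil b⟩
  | cons r L ih =>
    obtain ⟨T, a, c, hd⟩ := ZigArrow.exists_isDiamond hb hL.1
    obtain ⟨A', L', b', hs⟩ := ih hd.descending hL.2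
    exact ⟨_, _, _, .cons hd hs⟩

theorem IsStrip.unique {Z W A' A : C} {b : ZigArrow Z W} {L : HomZigzag W A}
    {L' : HomZigzag Z A'} {b' : ZigArrow A' A} (h : IsStrip b L L' b') (hb : b.Descending)
    (hL : L.All ZigArrow.Ascending) {Z₁ W₁ A₁' A₁ : C} {b₁ : ZigArrow Z₁ W₁} {L₁ : HomZigzag W₁ A₁}
    {L₁' : HomZigzag Z₁ A₁'} {b₁' : ZigArrow A₁' A₁} (h₁ : IsStrip b₁ L₁ L₁' b₁')
    (hb₁ : b₁.Descending) (hL₁ : L₁.All ZigArrow.Ascending) {φ : Z ≅ Z₁} {ψ : W ≅ W₁} {α : A ≅ A₁}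
    (hbb : ZigArrow.Similar φ ψ b b₁) (hLL : Similar ψ α L L₁) :
    ∃ α' : A' ≅ A₁', Similar φ α' L' L₁' ∧ ZigArrow.Similar α' α b' b₁' := by
  induction h generalizing Z₁ W₁ A₁' A₁ with
  | nil =>
    cases hLL
    cases h₁
    exact ⟨φ, .nil φ, hbb⟩
  | cons hd hs ih =>
    cases hLL with
    | cons hrr hLL =>
      cases h₁ with
      | cons hd₁ hs₁ =>
        obtain ⟨χ, h1, h2⟩ := hd.unique hd₁ hb hL.1 hb₁ hL₁.1 hbb hrr
        obtain ⟨α', h3, h4⟩ := ih hd.descending hL.2 hs₁ hd₁.descending hL₁.2 h2 hLL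
        exact ⟨α', .cons h1 h3, h4⟩

theorem IsPyramid.all {X A Y : C} {z : HomZigzag X Y} {L : HomZigzag X A} {R : HomZigzag A Y}
    (h : IsPyramid z L R) : L.All ZigArrow.Ascending ∧ R.All ZigArrow.Descending := by
  induction h with
  | nil => exact ⟨trivial, trivial⟩
  | cons _ ht hs ih =>
    have := hs.all ht.descending
    exact ⟨⟨ht.ascending, this.1⟩, this.2, ih.2⟩

theorem IsPyramid.forward_eq {X A Y : C} {z : HomZigzag X Y} {L : HomZigzag X A}
    {R : HomZigzag A Y} (h : IsPyramid z L R) (S : Sub X) :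
    (L.append R).chaseForward S = z.chaseForward S := by
  rw [chaseForward_append]
  induction h with
  | nil => rfl
  | cons hp ht hs ih =>
    simp only [chaseForward]
    rw [hs.forward_eq ht.descending hp.all.1, ht.forward_eq, ih]

theorem IsPyramid.backward_eq {X A Y : C} {z : HomZigzag X Y} {L : HomZigzag X A}
    {R : HomZigzag A Y} (h : IsPyramid z L R) (T : Sub Y) :
    (L.append R).chaseBackward T = z.chaseBackward T := by
  rw [chaseBackward_append]
  induction h with
  | nil => rfl
  | cons hp ht hs ih =>
    simp only [chaseBackward]
    rw [hs.backward_eq ht.descending hp.all.1, ht.backward_eq, ih]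

theorem exists_isPyramid {X Y : C} (z : HomZigzag X Y) :
    ∃ (A : C) (L : HomZigzag X A) (R : HomZigzag A Y), IsPyramid z L R := by
  induction z with
  | nil => exact ⟨_, _, _, .nil _⟩
  | cons f z ih =>
    obtain ⟨A, L, R, hp⟩ := ih
    obtain ⟨Z, a, b, ht⟩ := ZigArrow.exists_isTriangle f
    obtain ⟨A', L', b', hs⟩ := exists_isStrip ht.descending hp.all.1
    exact ⟨_, _, _, .cons hp ht hs⟩

/-- Two pyramids with the same base have isomorphic sides. -/
theorem IsPyramid.unique {X A A₁ Y : C} {z : HomZigzag X Y} {L : HomZigzag X A}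
    {R : HomZigzag A Y} {L₁ : HomZigzag X A₁} {R₁ : HomZigzag A₁ Y} (h : IsPyramid z L R)
    (h₁ : IsPyramid z L₁ R₁) :
    ∃ α : A ≅ A₁, Similar (Iso.refl X) α L L₁ ∧ Similar α (Iso.refl Y) R R₁ := by
  induction h generalizing A₁ with
  | nil =>
    cases h₁
    exact ⟨Iso.refl _, .nil _, .nil _⟩
  | cons hp ht hs ih =>
    cases h₁ with
    | cons hp₁ ht₁ hs₁ =>
      obtain ⟨α, hL, hR⟩ := ih hp₁
      obtain ⟨χ, h1, h2⟩ := ht.unique ht₁ (ZigArrow.Similar.refl _)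
      obtain ⟨α', h3, h4⟩ :=
        hs.unique ht.descending hp.all.1 hs₁ ht₁.descending hp₁.all.1 h2 hL
      exact ⟨α', .cons h1 h3, .cons h4 hR⟩

theorem IsPyramid.collapsible {X A Y : C} {z : HomZigzag X Y} {L : HomZigzag X A}
    {R : HomZigzag A Y} (h : IsPyramid z L R) (hf : z.chaseForward ⊥ = ⊥)
    (hb : z.chaseBackward ⊤ = ⊤) : (L.append R).Collapsible := by
  rw [← h.forward_eq, chaseForward_append] at hf
  rw [← h.backward_eq, chaseBackward_append] at hb
  exact (collapsible_append L R).2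
    ⟨collapsible_of_chaseBackward h.all.1 hb, (eq_bot_of_chaseForward h.all.2 hf).2⟩

theorem Induces.direct_eq {X Y : C} {z : HomZigzag X Y} {h : X ⟶ Y} (hz : z.Induces h)
    (S : Sub X) : direct h S = z.chaseForward S := by
  obtain ⟨A, L, R, hp, hc, rfl⟩ := hz
  rw [direct_collapse, hp.forward_eq]

theorem Induces.inverse_eq {X Y : C} {z : HomZigzag X Y} {h : X ⟶ Y} (hz : z.Induces h)
    (T : Sub Y) : inverse h T = z.chaseBackward T := by
  obtain ⟨A, L, R, hp, hc, rfl⟩ := hz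
  rw [inverse_collapse, hp.backward_eq]

theorem Induces.eq_collapse {X Y : C} {z : HomZigzag X Y} {h : X ⟶ Y} (hz : z.Induces h)
    {A : C} {L : HomZigzag X A} {R : HomZigzag A Y} (hp : IsPyramid z L R) :
    ∃ hc : (L.append R).Collapsible, h = (L.append R).collapse hc := by
  have hc := hp.collapsible (by rw [← hz.direct_eq, direct_bot])
    (by rw [← hz.inverse_eq, inverse_top])
  obtain ⟨A₁, L₁, R₁, hp₁, hc₁, rfl⟩ := hz
  obtain ⟨α, hL, hR⟩ := hp₁.unique hp
  exact ⟨hc, by simpa using (hL.append hR).collapse_eq hc₁ hc⟩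

end HomZigzag

theorem mainTheorem1 {C : Type u} [Category.{v} C] [SubgroupForm.{w} C] [SelfDualAxioms C]
    {X Y : C} (z : HomZigzag X Y) :
    -- the zigzag induces a homomorphism if and only if the two chasing conditions hold
    ((∃ h : X ⟶ Y, z.Induces h) ↔
      z.chaseForward ⊥ = ⊥ ∧ z.chaseBackward ⊤ = ⊤) ∧
    -- the induced homomorphism is unique
    (∀ h h' : X ⟶ Y, z.Induces h → z.Induces h' → h = h') ∧
    -- and it is obtained from every pyramid with base `z`
    (∀ h : X ⟶ Y, z.Induces h →
      ∀ (A : C) (L : HomZigzag X A) (R : HomZigzag A Y), HomZigzag.IsPyramid z L R →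
        ∃ hc : (L.append R).Collapsible, h = (L.append R).collapse hc) ∧
    -- its direct and inverse image maps are given by chasing
    (∀ h : X ⟶ Y, z.Induces h →
      (∀ S : Sub X, direct h S = z.chaseForward S) ∧
      (∀ T : Sub Y, inverse h T = z.chaseBackward T)) := by
  refine ⟨⟨?_, ?_⟩, ?_, fun h hz A L R hp => hz.eq_collapse hp,
    fun h hz => ⟨hz.direct_eq, hz.inverse_eq⟩⟩
  · rintro ⟨h, hz⟩
    exact ⟨by rw [← hz.direct_eq, direct_bot], by rw [← hz.inverse_eq, inverse_top]⟩
  · rintro ⟨hf, hb⟩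
    obtain ⟨A, L, R, hp⟩ := HomZigzag.exists_isPyramid z
    exact ⟨_, A, L, R, hp, hp.collapsible hf hb, rfl⟩
  · rintro h h' hz ⟨A, L, R, hp, hc, rfl⟩
    exact (hz.eq_collapse hp).2
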